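/- Let $\mathcal H$ be a real Hilbert space, let $\beta,\mu\in\left]0,+\infty\right[$, let $A\colon\mathcal H\to 2^{\mathcal H}$ be maximally monotone, let $B\colon\mathcal H\to\mathcal H$ be monotone and $\mu$-Lipschitzian, and let $C\colon\mathcal H\to\mathcal H$ be $\beta$-cocoercive, i.e. $\langle x-y, Cx-Cy\rangle\ge\beta\|Cx-Cy\|^2$ for all $x,y\in\mathcal H$. Suppose that $\operatorname{zer}(A+B+C)=\{x\in\mathcal H : 0\in Ax+Bx+Cx\}$ is nonempty. Let $\zeta\in\left]0,1/2\right[$, let $\xi\in\left]0,+\infty\right[$, and let $\gamma>0$ be such that $$\gamma<\frac{1-\zeta}{\mu},\qquad \gamma<\frac{4\beta\zeta}{1+\xi},\qquad \gamma<\frac{\sqrt2-1}{\mu},\qquad \gamma<\frac{1-2\zeta}{\mu(\sqrt2+1)+2/(\beta\xi)}.$$ Let $(x_0,x_{-1})\in\mathcal H^2$ and let $(x_n)_{n\in\mathbb N}$ be generated by $$(\forall n\in\mathbb N)\qquad y_n=2x_n-x_{n-1},\qquad x_{n+1}=J_{\gamma A}\big(x_n-\gamma By_n-\gamma Cx_n\big),$$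 where $J_{\gamma A}=(\operatorname{Id}+\gamma A)^{-1}$ is the resolvent of $\gamma A$. Then $(x_n)_{n\in\mathbb N}$ converges weakly to some $\overline x\in\operatorname{zer}(A+B+C)$. -/

import Mathlib

open Filter Topology
open scoped Pointwise NNReal

namespace MonotoneOperator

variable {H : Type*} [NormedAddCommGroup H] [InnerProductSpace ℝ H]

/-- The graph of a set-valued operator `A : H → 2^H`. Sums and scalar multiples of set-valued
operators are the pointwise Minkowski ones: `(A + B) x = A x + B x`, `(γ • A) x = γ • A x`. -/
def graph (A : H → Set H) : Set (H × H) := {p | p.2 ∈ A p.1}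

/-- The inverse `A⁻¹ : u ↦ {x | u ∈ A x}` of a set-valued operator. -/
def inverse (A : H → Set H) : H → Set H := fun u => {x | u ∈ A x}

/-- The zero set `zer A = A⁻¹ 0`. -/
def zer (A : H → Set H) : Set H := inverse A 0

/-- A single-valued operator, regarded as a set-valued one. -/
def ofFun (T : H → H) : H → Set H := fun x => {T x}

/-- Monotonicity: `⟪x - y, u - v⟫ ≥ 0` for all `(x, u)` and `(y, v)` in the graph. -/
def IsMonotone (A : H → Set H) : Prop :=
  ∀ x u y v : H, u ∈ A x → v ∈ A y → 0 ≤ inner ℝ (x - y) (u - v)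

/-- Maximal monotonicity: `A` is monotone and no monotone operator has a graph that properly
contains the graph of `A`. -/
def IsMaximallyMonotone (A : H → Set H) : Prop :=
  IsMonotone A ∧ ¬ ∃ A' : H → Set H, IsMonotone A' ∧ graph A ⊂ graph A'

/-- The resolvent `J_A = (Id + A)⁻¹`, as a set-valued operator. -/
def resolvent (A : H → Set H) : H → Set H := inverse (ofFun id + A)

/-- `β`-cocoercivity of a single-valued operator. -/
def IsCocoercive (β : ℝ) (C : H → H) : Prop :=
  ∀ x y : H, β * ‖C x - C y‖ ^ 2 ≤ inner ℝ (x - y) (C x - C y)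

end MonotoneOperator

/-! Testing monotonicity of A at x_{n+2} against a zero z and against x_{n+1}, and that of B at
y_{n+1} against z, shows that ‖x_{n+1} - z‖², corrected by a cross term in B and by squared
increments, drops at each step by a positive multiple of ‖x_{n+2} - x_{n+1}‖² (`reflected_step`).
This Lyapunov function still dominates a multiple of ‖x_{n+1} - z‖² (`reflected_lower_bound`), so
the iterates are bounded, the increments vanish and ‖x_n - z‖ converges. Weak cluster points are
zeros by `neg_mem_of_weak_limit`, which tests A and D = B + C separately and so never needs
maximality of their sum. Opial's lemma then gives weak convergence. Ultrafilters replace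
subsequences throughout. -/

namespace MonotoneOperator

/-! ### Limits along ultrafilters -/

section Weak

variable {ι H : Type*} [NormedAddCommGroup H] [InnerProductSpace ℝ H]

/-- Bounded families in a Hilbert space converge weakly along every ultrafilter. -/
lemma exists_weak_limit [CompleteSpace H] (U : Ultrafilter ι) {x : ι → H} {R : ℝ}
    (hx : ∀ i, ‖x i‖ ≤ R) :
    ∃ w : H, ∀ h : H, Tendsto (fun i => inner ℝ (x i) h) U (𝓝 (inner ℝ w h)) := by
  let f : ι → WeakDual ℝ H := fun i => StrongDual.toWeakDual (InnerProductSpace.toDual ℝ H (x i))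
  have hK := WeakDual.isCompact_closedBall (𝕜 := ℝ) (E := H) 0 R
  have hU : ((U.map f : Ultrafilter (WeakDual ℝ H)) : Filter (WeakDual ℝ H)) ≤
      𝓟 (WeakDual.toStrongDual ⁻¹' Metric.closedBall (0 : StrongDual ℝ H) R) := by
    rw [le_principal_iff, Ultrafilter.mem_coe, Ultrafilter.mem_map]
    refine univ_mem' fun i => ?_
    change InnerProductSpace.toDual ℝ H (x i) ∈ Metric.closedBall 0 R
    simpa using hx i
  obtain ⟨g, -, hg⟩ := hK.ultrafilter_le_nhds _ hU
  refine ⟨(InnerProductSpace.toDual ℝ H).symm (WeakDual.toStrongDual g), fun h => ?_⟩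
  have h1 : Tendsto (fun i => f i h) U (𝓝 (g h)) :=
    ((WeakDual.eval_continuous h).tendsto g).comp hg
  rw [InnerProductSpace.toDual_symm_apply]
  exact h1

/-- Bounded real families converge along every ultrafilter. -/
lemma exists_real_limit (U : Ultrafilter ι) {s : ι → ℝ} {R : ℝ} (hs : ∀ i, |s i| ≤ R) :
    ∃ c, Tendsto s U (𝓝 c) := by
  obtain ⟨c, -, hc⟩ := (isCompact_closedBall (0 : ℝ) R).ultrafilter_le_nhds (U.map s) (by
    rw [le_principal_iff, Ultrafilter.mem_coe, Ultrafilter.mem_map]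
    refine univ_mem' fun i => ?_
    change s i ∈ Metric.closedBall 0 R
    simpa using hs i)
  exact ⟨c, hc⟩

/-- Products of a bounded family with a null family vanish in the limit. -/
lemma tendsto_inner_of_bounded {l : Filter ι} {x r : ι → H} {R : ℝ} (hx : ∀ i, ‖x i‖ ≤ R)
    (hr : Tendsto r l (𝓝 0)) : Tendsto (fun i => inner ℝ (x i) (r i)) l (𝓝 0) := by
  refine squeeze_zero_norm (a := fun i => R * ‖r i‖) (fun i => ?_) ?_
  · exact (norm_inner_le_norm _ _).trans (mul_le_mul_of_nonneg_right (hx i) (norm_nonneg _))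
  · simpa using (tendsto_norm_zero.comp hr).const_mul R

end Weak

variable {ι H : Type*} [NormedAddCommGroup H] [InnerProductSpace ℝ H]

/-! ### Weak-strong closedness and Opial's lemma -/

/-- A pair that is monotonically related to the graph of a maximally monotone operator belongs
to the graph. -/
lemma IsMaximallyMonotone.mem {A : H → Set H} (hA : IsMaximallyMonotone A) {w v : H}
    (h : ∀ z u, u ∈ A z → 0 ≤ inner ℝ (w - z) (v - u)) : v ∈ A w := by
  by_contra hv
  refine hA.2 ⟨fun z => {u | u ∈ A z ∨ z = w ∧ u = v}, ?_, ?_⟩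
  · rintro a u b u' (ha | ⟨rfl, rfl⟩) (hb | ⟨rfl, rfl⟩)
    · exact hA.1 _ _ _ _ ha hb
    · have := h _ _ ha
      rwa [← neg_sub a, ← neg_sub u, inner_neg_neg] at this
    · exact h _ _ hb
    · simp
  · refine ⟨fun p hp => Or.inl hp, fun hs => hv ?_⟩
    exact hs (show (w, v) ∈ graph _ from Or.inr ⟨rfl, rfl⟩)

/-- A continuous monotone operator `D` takes the value `v` at `w` as soon as `(w, v)` is
monotonically related to its graph. -/
lemma eq_of_monotonically_related {D : H → H} (hD : Continuous D) {w v : H}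
    (h : ∀ z, 0 ≤ inner ℝ (w - z) (v - D z)) : v = D w := by
  -- Minty's trick: test at w - t k, divide by t > 0 and let t → 0.
  have key : ∀ k : H, 0 ≤ inner ℝ k (v - D w) := fun k => by
    have h1 : Tendsto (fun t : ℝ => inner ℝ k (v - D (w - t • k))) (𝓝[>] 0)
        (𝓝 (inner ℝ k (v - D (w - (0 : ℝ) • k)))) := by
      refine Tendsto.mono_left (Continuous.tendsto ?_ 0) nhdsWithin_le_nhds
      fun_prop
    simp only [zero_smul, sub_zero] at h1
    refine ge_of_tendsto h1 ?_
    filter_upwards [self_mem_nhdsWithin] with t ht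
    have h2 := h (w - t • k)
    rw [sub_sub_cancel, inner_smul_left] at h2
    exact nonneg_of_mul_nonneg_right h2 ht
  have h3 := key (-(v - D w))
  rw [inner_neg_left, real_inner_self_eq_norm_sq] at h3
  have h4 : ‖v - D w‖ = 0 := by nlinarith [norm_nonneg (v - D w)]
  exact sub_eq_zero.1 (norm_eq_zero.1 h4)

/-- The sum of a maximally monotone operator and a continuous monotone operator is sequentially
closed from weak to strong along bounded families. -/
lemma neg_mem_of_weak_limit [CompleteSpace H] {A : H → Set H} (hA : IsMaximallyMonotone A)
    {D : H → H} (hDc : Continuous D) (hDm : ∀ a b, 0 ≤ inner ℝ (a - b) (D a - D b))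
    (U : Ultrafilter ι) {x a : ι → H} (ha : ∀ i, a i ∈ A (x i))
    {R S : ℝ} (hx : ∀ i, ‖x i‖ ≤ R) (hS : ∀ i, ‖D (x i)‖ ≤ S)
    (hr : Tendsto (fun i => a i + D (x i)) U (𝓝 0)) {w : H}
    (hw : ∀ h : H, Tendsto (fun i => inner ℝ (x i) h) U (𝓝 (inner ℝ w h))) :
    -D w ∈ A w := by
  obtain ⟨v, hv⟩ := exists_weak_limit U hS
  obtain ⟨s, hs⟩ := exists_real_limit U (s := fun i => inner ℝ (x i) (D (x i))) (R := R * S)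
    fun i => (abs_real_inner_le_norm _ _).trans
      (mul_le_mul (hx i) (hS i) (norm_nonneg _) ((norm_nonneg _).trans (hx i)))
  have hxr := tendsto_inner_of_bounded hx hr
  have hrc : ∀ z : H, Tendsto (fun i => inner ℝ z (a i + D (x i))) U (𝓝 0) := fun z =>
    tendsto_inner_of_bounded (fun _ => le_rfl) hr
  have hDlim : ∀ z u : H, Tendsto (fun i => inner ℝ (x i - z) (D (x i) - u)) U
      (𝓝 (s - inner ℝ v z - inner ℝ w u + inner ℝ z u)) := fun z u => by
    refine (((hs.sub (hv z)).sub (hw u)).add_const (inner ℝ z u)).congr fun i => ?_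
    simp only [inner_sub_left, inner_sub_right, real_inner_comm z (D (x i))]
    ring
  have hAlim : ∀ z u : H, Tendsto (fun i => inner ℝ (x i - z) (a i - u)) U
      (𝓝 (-s + inner ℝ v z - inner ℝ w u + inner ℝ z u)) := fun z u => by
    have := ((hxr.sub (hrc z)).sub (hDlim z (-u)))
    convert this using 2 with i
    · simp only [inner_sub_left, inner_sub_right, inner_add_right, inner_neg_right]
      ring
    · simp only [inner_neg_right]
      ring
  -- Monotonicity of D bounds s below by ⟪v, w⟫, which makes (w, -v) monotonically related to A;
  -- testing A at that very pair then gives s = ⟪v, w⟫, which in turn identifies v with D w.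
  have hs1 : inner ℝ v w ≤ s := by
    have := ge_of_tendsto' (hDlim w (D w)) fun i => hDm _ _
    linarith
  have hvA : -v ∈ A w := hA.mem fun z u hu => by
    have := ge_of_tendsto' (hAlim z u) fun i => hA.1 _ _ _ _ (ha i) hu
    simp only [inner_sub_left, inner_sub_right, inner_neg_right]
    linarith [real_inner_comm v w, real_inner_comm v z]
  have hs2 : s ≤ inner ℝ v w := by
    have := ge_of_tendsto' (hAlim w (-v)) fun i => hA.1 _ _ _ _ (ha i) hvA
    linarith
  have hvD : v = D w := eq_of_monotonically_related hDc fun z => by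
    have := ge_of_tendsto' (hDlim z (D z)) fun i => hDm _ _
    simp only [inner_sub_left, inner_sub_right]
    linarith [real_inner_comm v w, real_inner_comm v z]
  rwa [← hvD]

/-- Opial's lemma: a bounded sequence whose distance to each of its weak cluster points
converges is weakly convergent. -/
lemma exists_weak_limit_of_opial [CompleteSpace H] {x : ℕ → H} {R : ℝ} (hx : ∀ n, ‖x n‖ ≤ R)
    (Z : Set H) (hZ : ∀ z ∈ Z, ∃ c, Tendsto (fun n => ‖x n - z‖ ^ 2) atTop (𝓝 c))
    (hcl : ∀ (U : Ultrafilter ℕ) (w : H), (U : Filter ℕ) ≤ atTop →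
      (∀ h, Tendsto (fun n => inner ℝ (x n) h) U (𝓝 (inner ℝ w h))) → w ∈ Z) :
    ∃ w ∈ Z, Tendsto (fun n => toWeakSpace ℝ H (x n)) atTop (𝓝 (toWeakSpace ℝ H w)) := by
  obtain ⟨w, hw⟩ := exists_weak_limit (hyperfilter ℕ) hx
  have hle : (hyperfilter ℕ : Filter ℕ) ≤ atTop := Nat.hyperfilter_le_atTop
  have hwZ := hcl _ w hle hw
  have hlim : ∀ h, Tendsto (fun n => inner ℝ (x n) h) atTop (𝓝 (inner ℝ w h)) := fun h => by
    rw [tendsto_iff_ultrafilter]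
    intro U hU
    obtain ⟨w', hw'⟩ := exists_weak_limit U hx
    have hwZ' := hcl U w' hU hw'
    obtain ⟨c, hc⟩ := hZ w hwZ
    obtain ⟨c', hc'⟩ := hZ w' hwZ'
    -- Subtracting the two squared distances cancels ‖x n‖², so both cluster points pair equally
    -- with w - w'.
    have hdiff : Tendsto (fun n => inner ℝ (x n) (w - w')) atTop
        (𝓝 ((c' - c + ‖w‖ ^ 2 - ‖w'‖ ^ 2) / 2)) := by
      refine ((((hc'.sub hc).add_const (‖w‖ ^ 2)).sub_const (‖w'‖ ^ 2)).div_const 2).congr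
        fun n => ?_
      rw [norm_sub_sq_real, norm_sub_sq_real, inner_sub_right]
      ring
    have e1 := tendsto_nhds_unique (hw (w - w')) (hdiff.mono_left hle)
    have e2 := tendsto_nhds_unique (hw' (w - w')) (hdiff.mono_left hU)
    have e3 : inner ℝ (w - w') (w - w') = (0 : ℝ) := by
      rw [inner_sub_left, e1, e2, sub_self]
    have e4 : w = w' := sub_eq_zero.1 (inner_self_eq_zero.1 e3)
    rw [e4]
    exact hw' h
  refine ⟨w, hwZ, ?_⟩
  refine ((WeakBilin.isEmbedding (B := (topDualPairing ℝ H).flip) ?_).tendsto_nhds_iff).2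
    (tendsto_pi_nhds.2 fun f => ?_)
  · intro p q hpq
    refine ext_inner_left ℝ fun v => ?_
    exact LinearMap.congr_fun hpq (InnerProductSpace.toDual ℝ H v)
  · have h1 := hlim ((InnerProductSpace.toDual ℝ H).symm f)
    simp only [real_inner_comm ((InnerProductSpace.toDual ℝ H).symm f),
      InnerProductSpace.toDual_symm_apply] at h1
    exact h1

/-- Membership in the resolvent of a positive multiple of `A`. -/
lemma exists_mem_of_mem_resolvent {A : H → Set H} {γ : ℝ} {p w : H}
    (h : p ∈ resolvent (γ • A) w) : ∃ a ∈ A p, p + γ • a = w := by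
  change w ∈ ({p} : Set H) + γ • A p at h
  obtain ⟨_, rfl, _, ⟨a, ha, rfl⟩, rfl⟩ := Set.mem_add.1 h
  exact ⟨a, ha, rfl⟩

omit [InnerProductSpace ℝ H] in
/-- Zeros of `A + B + C` with `B` and `C` single-valued. -/
lemma mem_zer_add_add_iff {A : H → Set H} {B C : H → H} {z : H} :
    z ∈ zer (A + ofFun B + ofFun C) ↔ -(B z + C z) ∈ A z := by
  change (0 : H) ∈ A z + {B z} + {C z} ↔ _
  simp only [Set.mem_add, Set.mem_singleton_iff]
  constructor
  · rintro ⟨_, ⟨a, ha, _, rfl, rfl⟩, _, rfl, h⟩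
    rwa [show -(B z + C z) = a by rw [neg_eq_iff_add_eq_zero, ← h]; abel]
  · intro h
    exact ⟨_, ⟨_, h, _, rfl, rfl⟩, _, rfl, by abel⟩

lemma IsCocoercive.norm_sub_le {β : ℝ} {C : H → H} (hC : IsCocoercive β C) (x y : H) :
    β * ‖C x - C y‖ ≤ ‖x - y‖ := by
  rcases (norm_nonneg (C x - C y)).eq_or_lt with h | h
  · rw [← h]; simp
  · have h1 := (hC x y).trans (real_inner_le_norm _ _)
    refine le_of_mul_le_mul_right ?_ h
    linarith

/-! ### Lyapunov estimates -/

/-- The one-step estimate for the reflected forward-backward iteration. -/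
lemma reflected_step {β γ μ τ : ℝ} (hβ : 0 < β) (hγ : 0 < γ) (hμ : 0 < μ) (hτ : 0 < τ)
    (hτ2 : τ ^ 2 = 2) (hm : γ * μ * (τ + 1) < 1) {X d d' e b b' c c₂ : H}
    (h1 : 0 ≤ inner ℝ (X + d') (-d' - γ • b' - γ • c))
    (h2 : 0 ≤ inner ℝ d' (d - d' - γ • (b' - b) - γ • c₂))
    (h3 : 0 ≤ inner ℝ (X + d) b')
    (h4 : ‖b' - b‖ ≤ μ * ‖d + e‖)
    (h5 : β * ‖c‖ ^ 2 ≤ inner ℝ X c)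
    (h6 : β * ‖c₂‖ ≤ ‖d‖) :
    ‖X + d'‖ ^ 2 + 2 * γ * inner ℝ d' b' + (2 - 3 / 2 * (γ / β)) * ‖d'‖ ^ 2
        + γ * μ * ‖d' - d‖ ^ 2 ≤
      ‖X‖ ^ 2 + 2 * γ * inner ℝ d b + (1 + γ * μ * (τ + 1) + γ / β) * ‖d‖ ^ 2
        + γ * μ * ‖e‖ ^ 2 := by
  have k1 : -inner ℝ (d' - d) (b' - b) ≤ ‖d' - d‖ * (μ * (‖d‖ + ‖e‖)) :=
    (neg_le_abs _).trans ((abs_real_inner_le_norm _ _).trans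
      (mul_le_mul_of_nonneg_left (h4.trans
        (mul_le_mul_of_nonneg_left (norm_add_le _ _) hμ.le)) (norm_nonneg _)))
  have k1' : 2 * (‖d' - d‖ * (‖d‖ + ‖e‖)) ≤
      τ * ‖d' - d‖ ^ 2 + ‖e‖ ^ 2 + (τ + 1) * ‖d‖ ^ 2 := by
    -- Young's inequality with weights τ - 1 and τ + 1, whose product is 1 because τ² = 2.
    have : 0 ≤ (τ + 1) * (‖d‖ - (τ - 1) * ‖d' - d‖) ^ 2 := by positivity
    have e1 : (τ + 1) * (‖d‖ - (τ - 1) * ‖d' - d‖) ^ 2 =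
        (τ + 1) * ‖d‖ ^ 2 - 2 * (τ ^ 2 - 1) * (‖d‖ * ‖d' - d‖)
          + (τ ^ 2 - 1) * (τ - 1) * ‖d' - d‖ ^ 2 := by ring
    rw [e1, hτ2] at this
    nlinarith [sq_nonneg (‖d' - d‖ - ‖e‖)]
  have K1 : -(2 * γ * inner ℝ (d' - d) (b' - b)) ≤
      γ * μ * (τ * ‖d' - d‖ ^ 2 + ‖e‖ ^ 2 + (τ + 1) * ‖d‖ ^ 2) := by
    have a1 := mul_le_mul_of_nonneg_left k1 hγ.le
    have a2 := mul_le_mul_of_nonneg_left k1' (mul_pos hγ hμ).le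
    nlinarith
  -- The weight is chosen so that cocoercivity `h5` absorbs the ‖c‖² term exactly.
  have K2 : -(2 * γ * inner ℝ d' c) ≤ 2 * γ * β * ‖c‖ ^ 2 + 1 / 2 * (γ / β) * ‖d'‖ ^ 2 := by
    have a1 : -inner ℝ d' c ≤ ‖d'‖ * ‖c‖ :=
      (neg_le_abs _).trans (abs_real_inner_le_norm _ _)
    have a2 : 0 ≤ 2 * γ * β * (‖c‖ - ‖d'‖ / (2 * β)) ^ 2 := by positivity
    have a3 : 2 * γ * β * (‖c‖ - ‖d'‖ / (2 * β)) ^ 2 =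
        2 * γ * β * ‖c‖ ^ 2 + 1 / 2 * (γ / β) * ‖d'‖ ^ 2 - 2 * γ * (‖d'‖ * ‖c‖) := by
      field_simp
      ring
    have a4 := mul_le_mul_of_nonneg_left a1 hγ.le
    linarith
  have K3 : -(2 * γ * inner ℝ d' c₂) ≤ γ / β * (‖d'‖ ^ 2 + ‖d‖ ^ 2) := by
    have a1 : -inner ℝ d' c₂ ≤ ‖d'‖ * (‖d‖ / β) :=
      (neg_le_abs _).trans ((abs_real_inner_le_norm _ _).trans
        (mul_le_mul_of_nonneg_left ((le_div_iff₀' hβ).2 h6) (norm_nonneg _)))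
    have a2 : 0 ≤ γ / β * (‖d'‖ - ‖d‖) ^ 2 := by positivity
    have a3 : γ / β * (‖d'‖ - ‖d‖) ^ 2 =
        γ / β * (‖d'‖ ^ 2 + ‖d‖ ^ 2) - 2 * γ * (‖d'‖ * (‖d‖ / β)) := by
      field_simp
      ring
    have a4 := mul_le_mul_of_nonneg_left a1 hγ.le
    linarith
  have K4 : γ * μ * (τ + 1) * ‖d' - d‖ ^ 2 ≤ ‖d' - d‖ ^ 2 :=
    mul_le_of_le_one_left (sq_nonneg _) hm.le
  have K5 := mul_nonneg hγ.le h3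
  have K6 := mul_le_mul_of_nonneg_left h5 hγ.le
  have N1 : ‖d' - d‖ ^ 2 = ‖d'‖ ^ 2 - 2 * inner ℝ d' d + ‖d‖ ^ 2 := norm_sub_sq_real _ _
  have N2 : ‖X + d'‖ ^ 2 = ‖X‖ ^ 2 + 2 * inner ℝ X d' + ‖d'‖ ^ 2 := norm_add_sq_real _ _
  simp only [inner_add_left, inner_sub_left, inner_sub_right, inner_neg_right, inner_smul_right,
    real_inner_self_eq_norm_sq] at h1 h2 K1 K5
  nlinarith

/-- Lower bound for the Lyapunov function of the reflected forward-backward iteration. -/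
lemma reflected_lower_bound {γ μ K : ℝ} (hγ : 0 < γ) (hμ : 0 < μ)
    (hK : 2 * (γ * μ) ≤ K) {X d e b : H} (h : ‖b‖ ≤ μ * ‖X - e‖) :
    (1 - γ * μ) * ‖X‖ ^ 2 ≤
      ‖X‖ ^ 2 + 2 * γ * inner ℝ d b + K * ‖d‖ ^ 2 + γ * μ * ‖e‖ ^ 2 := by
  have k1 : -inner ℝ d b ≤ ‖d‖ * (μ * (‖X‖ + ‖e‖)) :=
    (neg_le_abs _).trans ((abs_real_inner_le_norm _ _).trans
      (mul_le_mul_of_nonneg_left (h.trans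
        (mul_le_mul_of_nonneg_left (norm_sub_le _ _) hμ.le)) (norm_nonneg _)))
  have a1 := mul_le_mul_of_nonneg_left k1 hγ.le
  have a2 := mul_nonneg (mul_pos hγ hμ).le
    (add_nonneg (sq_nonneg (‖d‖ - ‖X‖)) (sq_nonneg (‖d‖ - ‖e‖)))
  have a3 := mul_le_mul_of_nonneg_right hK (sq_nonneg ‖d‖)
  nlinarith

/-- A nonnegative sequence whose decrease dominates a positive multiple of `s n` converges, and
`s` vanishes in the limit. -/
lemma tendsto_of_decrease {V s : ℕ → ℝ} {δ : ℝ} (hδ : 0 < δ) (hV : ∀ n, 0 ≤ V n)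
    (hs : ∀ n, 0 ≤ s n) (h : ∀ n, V (n + 1) + δ * s n ≤ V n) :
    (∃ c, Tendsto V atTop (𝓝 c)) ∧ Tendsto s atTop (𝓝 0) := by
  have hanti : Antitone V := antitone_nat_of_succ_le fun n => by
    have := h n
    have := mul_nonneg hδ.le (hs n)
    linarith
  have hlim := tendsto_atTop_ciInf hanti ⟨0, by rintro _ ⟨n, rfl⟩; exact hV n⟩
  refine ⟨⟨_, hlim⟩, ?_⟩
  have h1 : Tendsto (fun n => (V n - V (n + 1)) / δ) atTop (𝓝 0) := by
    simpa using (hlim.sub (hlim.comp (tendsto_add_atTop_nat 1))).div_const δ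
  refine squeeze_zero hs (fun n => ?_) h1
  rw [le_div_iff₀' hδ]
  linarith [h n]

end MonotoneOperator

/-! ### Convergence of the iteration -/

open MonotoneOperator in
theorem theorem2 {H : Type*} [NormedAddCommGroup H] [InnerProductSpace ℝ H] [CompleteSpace H]
    (A : H → Set H) (B C : H → H) (μ : ℝ≥0) (β ζ ξ γ : ℝ)
    (hA : MonotoneOperator.IsMaximallyMonotone A)
    (hμ : 0 < μ)
    (hB : MonotoneOperator.IsMonotone (MonotoneOperator.ofFun B))
    (hBL : LipschitzWith μ B)
    (hβ : 0 < β)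
    (hC : MonotoneOperator.IsCocoercive β C)
    (hzer : (MonotoneOperator.zer
      (A + MonotoneOperator.ofFun B + MonotoneOperator.ofFun C)).Nonempty)
    (hζ : ζ ∈ Set.Ioo (0 : ℝ) (1 / 2))
    (hξ : 0 < ξ)
    (hγ : 0 < γ)
    (hγ₁ : γ < (1 - ζ) / μ)
    (hγ₂ : γ < 4 * β * ζ / (1 + ξ))
    (hγ₃ : γ < (√2 - 1) / μ)
    (hγ₄ : γ < (1 - 2 * ζ) / (μ * (√2 + 1) + 2 / (β * ξ)))
    (x_neg_one : H) (x y : ℕ → H)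
    (hy_zero : y 0 = (2 : ℝ) • x 0 - x_neg_one)
    (hy_succ : ∀ n, y (n + 1) = (2 : ℝ) • x (n + 1) - x n)
    (hx : ∀ n, x (n + 1) ∈
      MonotoneOperator.resolvent (γ • A) (x n - γ • B (y n) - γ • C (x n))) :
    ∃ x_bar ∈ MonotoneOperator.zer
        (A + MonotoneOperator.ofFun B + MonotoneOperator.ofFun C),
      Tendsto (fun n => toWeakSpace ℝ H (x n)) atTop (𝓝 (toWeakSpace ℝ H x_bar)) := by
  have hμ' : (0 : ℝ) < μ := hμ
  obtain ⟨hζ0, hζ1⟩ := hζ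
  set τ : ℝ := √2
  have hτ : 0 < τ := Real.sqrt_pos.2 two_pos
  have hτ2 : τ ^ 2 = 2 := Real.sq_sqrt two_pos.le
  have hm0 : 0 < γ * μ := mul_pos hγ hμ'
  have hm1 : γ * μ < τ - 1 := (lt_div_iff₀ hμ').1 hγ₃
  have hm : γ * μ * (τ + 1) < 1 := by nlinarith
  have hτ3 : τ < 3 / 2 := by nlinarith
  have hq : 0 < γ / β := div_pos hγ hβ
  -- The gap between the coefficients of ‖d'‖² and ‖d‖² in `reflected_step`. Half of `g2` plus `g4`
  -- eliminates ζ, and ξ/2 + 2/ξ ≥ 2 eliminates ξ.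
  have hδ : 0 < 1 - γ * μ * (τ + 1) - 5 / 2 * (γ / β) := by
    have g2 : γ / β * (1 + ξ) < 4 * ζ := by
      rw [lt_div_iff₀ (by positivity)] at hγ₂
      rw [div_mul_eq_mul_div, div_lt_iff₀ hβ]
      linarith
    have g4 : γ * μ * (τ + 1) + 2 * (γ / β / ξ) < 1 - 2 * ζ := by
      rw [lt_div_iff₀ (by positivity)] at hγ₄
      have : γ * (μ * (τ + 1) + 2 / (β * ξ)) = γ * μ * (τ + 1) + 2 * (γ / β / ξ) := by
        field_simp
      linarith
    have g5 : 2 * (γ / β) ≤ γ / β * (ξ / 2) + 2 * (γ / β / ξ) := by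
      have : γ / β * (ξ / 2) + 2 * (γ / β / ξ) - 2 * (γ / β) =
          γ / β * ((ξ - 2) ^ 2 / (2 * ξ)) := by
        field_simp
        ring
      have : 0 ≤ γ / β * ((ξ - 2) ^ 2 / (2 * ξ)) := by positivity
      linarith
    linarith
  choose a haA ha using fun n => exists_mem_of_mem_resolvent (hx n)
  have hγa : ∀ n, γ • a n = x n - γ • B (y n) - γ • C (x n) - x (n + 1) := fun n =>
    eq_sub_of_add_eq' (ha n)
  have hBm : ∀ p q, 0 ≤ inner ℝ (p - q) (B p - B q) := fun p q => hB p _ q _ rfl rfl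
  have hBn : ∀ p q, ‖B p - B q‖ ≤ μ * ‖p - q‖ := fun p q => hBL.norm_sub_le p q
  have hCn := hC.norm_sub_le
  obtain ⟨V, hV⟩ : ∃ V : H → ℕ → ℝ, ∀ z n, V z n = ‖x (n + 1) - z‖ ^ 2
      + 2 * γ * inner ℝ (x (n + 1) - x n) (B (y n) - B z)
      + (1 + γ * μ * (τ + 1) + γ / β) * ‖x (n + 1) - x n‖ ^ 2
      + γ * μ * ‖x (n + 1) - y n‖ ^ 2 := ⟨_, fun _ _ => rfl⟩
  have hlow : ∀ z n, (1 - γ * μ) * ‖x (n + 1) - z‖ ^ 2 ≤ V z n := fun z n => by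
    rw [hV]
    refine reflected_lower_bound hγ hμ' (by nlinarith) ?_
    rw [sub_sub_sub_cancel_left]
    exact hBn _ _
  have hm2 : 0 < 1 - γ * μ := by linarith
  have hV0 : ∀ z n, 0 ≤ V z n := fun z n =>
    (mul_nonneg hm2.le (sq_nonneg _)).trans (hlow z n)
  have hstep : ∀ z ∈ zer (A + ofFun B + ofFun C), ∀ n,
      V z (n + 1) + (1 - γ * μ * (τ + 1) - 5 / 2 * (γ / β)) * ‖x (n + 2) - x (n + 1)‖ ^ 2
        ≤ V z n := by
    intro z hz n
    rw [mem_zer_add_add_iff] at hz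
    have hy2 : y (n + 1) = x (n + 1) + (x (n + 1) - x n) := by
      rw [hy_succ, two_smul]
      abel
    have h := reflected_step hβ hγ hμ' hτ hτ2 hm (X := x (n + 1) - z) (d := x (n + 1) - x n)
      (d' := x (n + 2) - x (n + 1)) (e := x (n + 1) - y n) (b := B (y n) - B z)
      (b' := B (y (n + 1)) - B z) (c := C (x (n + 1)) - C z) (c₂ := C (x (n + 1)) - C (x n))
      (by
        have h1 := mul_nonneg hγ.le (hA.1 _ _ _ _ (haA (n + 1)) hz)
        rw [← inner_smul_right, smul_sub, hγa] at h1
        refine h1.trans_eq (congrArg₂ (inner ℝ) ?_ ?_)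
        · exact (sub_add_sub_cancel' (x (n + 1)) z (x (n + 2))).symm
        · simp only [smul_sub, smul_neg, smul_add, add_assoc, Nat.reduceAdd]
          abel)
      (by
        have h1 := mul_nonneg hγ.le (hA.1 _ _ _ _ (haA (n + 1)) (haA n))
        rw [← inner_smul_right, smul_sub, hγa, hγa] at h1
        refine h1.trans_eq (congrArg₂ (inner ℝ) rfl ?_)
        simp only [smul_sub, add_assoc, Nat.reduceAdd]
        abel)
      (by
        rw [sub_add_eq_add_sub, ← hy2]
        exact hBm _ _)
      (by
        rw [sub_sub_sub_cancel_right,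
          show x (n + 1) - x n + (x (n + 1) - y n) = y (n + 1) - y n by rw [hy2]; abel]
        exact hBn _ _)
      (hC _ _) (hCn _ _)
    rw [show x (n + 1) - z + (x (n + 2) - x (n + 1)) = x (n + 2) - z by abel,
      show x (n + 2) - x (n + 1) - (x (n + 1) - x n) = x (n + 2) - y (n + 1) by
        rw [hy2]; abel] at h
    rw [hV, hV]
    linarith
  have hconv := fun z hz =>
    tendsto_of_decrease hδ (hV0 z) (fun n => sq_nonneg ‖x (n + 2) - x (n + 1)‖) (hstep z hz)
  obtain ⟨z₀, hz₀⟩ := hzer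
  have hd : Tendsto (fun n => x (n + 1) - x n) atTop (𝓝 0) := by
    rw [← tendsto_add_atTop_iff_nat 1, tendsto_zero_iff_norm_tendsto_zero]
    have := (hconv z₀ hz₀).2.sqrt
    simpa only [Real.sqrt_sq (norm_nonneg _), Real.sqrt_zero] using this
  have he : Tendsto (fun n => x (n + 1) - y n) atTop (𝓝 0) := by
    rw [← tendsto_add_atTop_iff_nat 1]
    have := (hd.comp (tendsto_add_atTop_nat 1)).sub hd
    rw [sub_zero] at this
    refine this.congr fun n => ?_
    simp only [Function.comp_apply, hy_succ, two_smul]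
    abel
  have hbdd : ∀ z ∈ zer (A + ofFun B + ofFun C), ∃ R, ∀ n, ‖x (n + 1) - z‖ ≤ R := by
    intro z hz
    obtain ⟨c, hc⟩ := (hconv z hz).1
    obtain ⟨M, hM⟩ := hc.bddAbove_range
    refine ⟨√(M / (1 - γ * μ)), fun n => Real.le_sqrt_of_sq_le ?_⟩
    rw [le_div_iff₀' hm2]
    exact (hlow z n).trans (hM ⟨n, rfl⟩)
  obtain ⟨R, hR⟩ := hbdd z₀ hz₀
  have hCn' : ∀ p q, ‖C p - C q‖ ≤ 1 / β * ‖p - q‖ := fun p q => by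
    rw [one_div_mul_eq_div, le_div_iff₀' hβ]
    exact hCn p q
  have hCc : Continuous C := by
    refine (LipschitzWith.of_dist_le' (K := 1 / β) fun p q => ?_).continuous
    simpa only [dist_eq_norm] using hCn' p q
  have hx1 : ∀ n, ‖x (n + 1)‖ ≤ R + ‖z₀‖ := fun n => by
    have := norm_le_norm_sub_add (x (n + 1)) z₀
    linarith [hR n]
  obtain ⟨w, hw, hlim⟩ := exists_weak_limit_of_opial (x := fun n => x (n + 1)) hx1
    (zer (A + ofFun B + ofFun C)) (fun z hz => by
      obtain ⟨c, hc⟩ := (hconv z hz).1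
      obtain ⟨R', hR'⟩ := hbdd z hz
      have hT : Tendsto (fun n => inner ℝ (x (n + 1) - x n) (B (y n) - B z)) atTop (𝓝 0) := by
        refine squeeze_zero_norm
          (a := fun n => ‖x (n + 1) - x n‖ * (μ * (R' + ‖x (n + 1) - y n‖))) (fun n => ?_) ?_
        · refine (norm_inner_le_norm _ _).trans (mul_le_mul_of_nonneg_left
            ((hBn _ _).trans (mul_le_mul_of_nonneg_left ?_ hμ'.le)) (norm_nonneg _))
          rw [← sub_sub_sub_cancel_left z (y n) (x (n + 1))]
          exact (norm_sub_le _ _).trans (add_le_add_left (hR' n) _)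
        · simpa using hd.norm.mul ((he.norm.const_add R').const_mul (μ : ℝ))
      refine ⟨_, (((hc.sub (hT.const_mul (2 * γ))).sub
        ((hd.norm.pow 2).const_mul (1 + γ * μ * (τ + 1) + γ / β))).sub
        ((he.norm.pow 2).const_mul (γ * μ))).congr fun n => ?_⟩
      rw [hV]
      ring)
    (fun U w hU hw => by
      rw [mem_zer_add_add_iff]
      refine neg_mem_of_weak_limit hA (D := fun p => B p + C p) (hBL.continuous.add hCc)
        (fun p q => ?_) U (x := fun n => x (n + 1)) haA hx1
        (S := (μ + 1 / β) * R + ‖B z₀ + C z₀‖) (fun n => ?_) ?_ hw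
      · have h1 := (mul_nonneg hβ.le (sq_nonneg _)).trans (hC p q)
        rw [add_sub_add_comm, inner_add_right]
        exact add_nonneg (hBm p q) h1
      · refine (norm_le_norm_sub_add _ (B z₀ + C z₀)).trans (add_le_add_left ?_ _)
        rw [add_sub_add_comm]
        refine (norm_add_le _ _).trans ((add_le_add (hBn _ _) (hCn' _ _)).trans ?_)
        rw [← add_mul]
        exact mul_le_mul_of_nonneg_left (hR n) (by positivity)
      · refine Tendsto.mono_left ?_ hU
        have hB0 : Tendsto (fun n => B (x (n + 1)) - B (y n)) atTop (𝓝 0) :=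
          squeeze_zero_norm (fun n => hBn _ _) (by simpa using he.norm.const_mul (μ : ℝ))
        have hC0 : Tendsto (fun n => C (x (n + 1)) - C (x n)) atTop (𝓝 0) :=
          squeeze_zero_norm (fun n => hCn' _ _) (by simpa using hd.norm.const_mul (1 / β))
        -- The resolvent identity makes this the residual a n + D (x (n + 1)).
        have h1 := (hB0.add hC0).sub (hd.const_smul γ⁻¹)
        rw [add_zero, smul_zero, sub_zero] at h1
        refine h1.congr fun n => ?_
        have h2 : a n = γ⁻¹ • (x n - γ • B (y n) - γ • C (x n) - x (n + 1)) := by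
          rw [← hγa, inv_smul_smul₀ hγ.ne']
        simp only [h2, smul_sub, inv_smul_smul₀ hγ.ne']
        abel)
  exact ⟨w, hw, (tendsto_add_atTop_iff_nat 1).1 hlim⟩
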